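/- Let $S_\infty=\bigcup_{n\ge 0}S_n$ be the group of permutations of $\{1,2,\ldots\}$ moving only finitely many letters, let $s_i=(i,i+1)$, and let $\partial_i f=\dfrac{f-f|_{x_i\leftrightarrow x_{i+1}}}{x_i-x_{i+1}}$. The double Schubert polynomials $\mathfrak{S}_w(x,t)\in\mathbb{Z}[x_1,x_2,\ldots;t_1,t_2,\ldots]$, $w\in S_\infty$, are determined by $$\mathfrak{S}_{n\cdots 21}(x,t)=\prod_{i+j\le n}(x_i-t_j)\quad(n\ge 1),\qquad \partial_i\mathfrak{S}_w(x,t)=\mathfrak{S}_{ws_i}(x,t)\ \text{ if } w(i)>w(i+1),$$ and the single Schubert polynomials are $\mathfrak{S}_w(x)=\mathfrak{S}_w(x,0)$. For $w\in S_\infty$ let $\mathrm{maxdes}(w)=\max\{i: w(i)>w(i+1)\}$ and $\mathrm{mindes}(w)=\min\{i: w(i)>w(i+1)\}$, with $\mathrm{maxdes}(\mathrm{id})=0$ and $\mathrm{mindes}(\mathrm{id})=+\infty$. **Corollary.** Let $u,v\in S_n$ be permutations with separated descents, that is, $\mathrm{maxdes}(u)\le k\le\mathrm{mindes}(v)$ for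 some $k$. Then $$\mathfrak{S}_u(x)\cdot\mathfrak{S}_v(x,t)\in\sum_{w\in S_\infty}\mathbb{Z}_{\ge 0}[t]\cdot\mathfrak{S}_w(x,t),$$ i.e. there are polynomials $c_w(t)\in\mathbb{Z}_{\ge 0}[t_1,t_2,\ldots]$, $w\in S_\infty$, only finitely many of them nonzero, with $\mathfrak{S}_u(x)\cdot\mathfrak{S}_v(x,t)=\sum_{w} c_w(t)\,\mathfrak{S}_w(x,t)$. -/

import Mathlib

namespace SchubertCalc

/-- The group `S_∞ = ⋃ S_n` of permutations moving only finitely many letters. Letters and positions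
are indexed from `0`: the number `i : ℕ` stands for the `(i + 1)`-st letter, so that `S_n` is the
subgroup of permutations fixing every `i ≥ n`. -/
def SInf : Subgroup (Equiv.Perm ℕ) where
  carrier := {w | {i | w i ≠ i}.Finite}
  mul_mem' := by
    intro a b ha hb
    refine (Set.Finite.union ha hb).subset ?_
    intro i hi
    by_contra h
    simp only [Set.mem_union, Set.mem_ofPred_eq, not_or, not_not] at h
    apply hi
    rw [Equiv.Perm.mul_apply, h.2, h.1]
  one_mem' := by simp
  inv_mem' := by
    intro a ha
    refine Set.Finite.subset ha ?_
    intro i hi h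
    apply hi
    rw [Equiv.Perm.inv_eq_iff_eq]
    exact h.symm

/-- The set of descents `{p ≥ 1 : w(p) > w(p + 1)}`, with positions `p` counted from `1` as usual:
the `p`-th position is the natural number `p - 1`. -/
def descents (w : Equiv.Perm ℕ) : Set ℕ :=
  {p | ∃ i : ℕ, p = i + 1 ∧ w (i + 1) < w i}

/-- The largest descent; it is `0` if there is no descent. (The descent set of an element of `S_∞` is
finite, so the supremum is a maximum as soon as there is a descent.) -/
noncomputable def maxdes (w : SInf) : ℕ := sSup (descents w.1)

/-- The smallest descent; it is `∞` if there is no descent. -/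
noncomputable def mindes (w : SInf) : ℕ∞ := ⨅ p ∈ descents w.1, (p : ℕ∞)

/-- `u` and `v` have separated descents: `maxdes u ≤ k ≤ mindes v` for some position `k`. -/
def SeparatedDescents (u v : SInf) : Prop :=
  ∃ k : ℕ, maxdes u ≤ k ∧ (k : ℕ∞) ≤ mindes v

section DividedDifference

open MvPolynomial

variable {R : Type*} [CommRing R]

theorem X_sub_X_dvd_sub_rename_swap (i : ℕ) (f : MvPolynomial ℕ R) :
    (X i - X (i + 1) : MvPolynomial ℕ R) ∣ f - rename (Equiv.swap i (i + 1)) f := by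
  induction f using MvPolynomial.induction_on with
  | C a => simp
  | add p q hp hq =>
    rw [map_add, add_sub_add_comm]
    exact dvd_add hp hq
  | mul_X p j hp =>
    have hX : (X i - X (i + 1) : MvPolynomial ℕ R) ∣ X j - X (Equiv.swap i (i + 1) j) := by
      by_cases h1 : j = i
      · subst h1; simp
      · by_cases h2 : j = i + 1
        · subst h2
          rw [Equiv.swap_apply_right]
          exact ⟨-1, by ring⟩
        · rw [Equiv.swap_apply_of_ne_of_ne h1 h2]; simp
    rw [map_mul, rename_X]
    have e : p * X j - rename (Equiv.swap i (i + 1)) p * X (Equiv.swap i (i + 1) j)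
        = (p - rename (Equiv.swap i (i + 1)) p) * X j
          + rename (Equiv.swap i (i + 1)) p * (X j - X (Equiv.swap i (i + 1) j)) := by ring
    rw [e]
    exact dvd_add (hp.mul_right _) (hX.mul_left _)

/-- The divided difference operator `∂ f = (f - f|_{x_i ↔ x_{i+1}}) / (x_i - x_{i+1})`, an exact
division of polynomials (the quotient is unique because `x_i - x_{i+1}` is not a zero divisor). -/
noncomputable def dividedDifference (i : ℕ) (f : MvPolynomial ℕ R) : MvPolynomial ℕ R :=
  (X_sub_X_dvd_sub_rename_swap i f).choose

theorem dividedDifference_spec (i : ℕ) (f : MvPolynomial ℕ R) :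
    f - rename (Equiv.swap i (i + 1)) f = (X i - X (i + 1)) * dividedDifference i f :=
  (X_sub_X_dvd_sub_rename_swap i f).choose_spec

end DividedDifference

theorem sum_mul_swap_lt {n i : ℕ} (w : Equiv.Perm ℕ) (hi : i + 1 < n) (hw : w i < w (i + 1)) :
    ∑ j ∈ Finset.range n, j * (w * Equiv.swap i (i + 1)) j < ∑ j ∈ Finset.range n, j * w j := by
  have h1 : i ∈ Finset.range n := Finset.mem_range.2 (by omega)
  have h2 : i + 1 ∈ (Finset.range n).erase i :=
    Finset.mem_erase.2 ⟨by omega, Finset.mem_range.2 hi⟩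
  rw [← Finset.add_sum_erase _ _ h1, ← Finset.add_sum_erase _ _ h2,
    ← Finset.add_sum_erase (Finset.range n) (fun j => j * w j) h1,
    ← Finset.add_sum_erase _ (fun j => j * w j) h2]
  have e : ∑ j ∈ ((Finset.range n).erase i).erase (i + 1), j * (w * Equiv.swap i (i + 1)) j
      = ∑ j ∈ ((Finset.range n).erase i).erase (i + 1), j * w j := by
    refine Finset.sum_congr rfl fun j hj => ?_
    simp only [Finset.mem_erase] at hj
    rw [Equiv.Perm.mul_apply, Equiv.swap_apply_of_ne_of_ne hj.2.1 hj.1]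
  rw [e]
  simp only [Equiv.Perm.mul_apply, Equiv.swap_apply_left, Equiv.swap_apply_right]
  nlinarith

/-- The ascents of `w` among its first `n` letters. -/
def ascents (n : ℕ) (w : Equiv.Perm ℕ) : Set ℕ := {i | i + 1 < n ∧ w i < w (i + 1)}

open Classical in
/-- The double Schubert polynomial of `w ∈ S_n`, as a polynomial in `x_1, x_2, …` with coefficients in
`ℤ[t_1, t_2, …]` (the variable of index `i` being `x_{i+1}`, respectively `t_{i+1}`). If `w` has an
ascent `w(i) < w(i+1)` among its first `n` letters, then `𝔖_w = ∂_i 𝔖_{w s_i}`, for the first such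
ascent; otherwise `w = n ⋯ 2 1` and `𝔖_w = ∏_{i + j ≤ n} (x_i - t_j)`, with `i, j ≥ 1`. -/
noncomputable def doubleSchubertAux (n : ℕ) (w : Equiv.Perm ℕ) :
    MvPolynomial ℕ (MvPolynomial ℕ ℤ) :=
  if h : (ascents n w).Nonempty then
    dividedDifference (sInf (ascents n w))
      (doubleSchubertAux n (w * Equiv.swap (sInf (ascents n w)) (sInf (ascents n w) + 1)))
  else
    ∏ p ∈ (Finset.range n ×ˢ Finset.range n).filter (fun p => (p.1 + 1) + (p.2 + 1) ≤ n),
      (MvPolynomial.X p.1 - MvPolynomial.C (MvPolynomial.X p.2))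
termination_by ∑ j ∈ Finset.range n, j * w j
decreasing_by exact sum_mul_swap_lt w (Nat.sInf_mem h).1 (Nat.sInf_mem h).2

/-- The least `n` with `w ∈ S_n`. -/
noncomputable def size (w : SInf) : ℕ := sInf {n | ∀ i, n ≤ i → w.1 i = i}

/-- The double Schubert polynomial `𝔖_w(x, t)` of `w ∈ S_∞`. -/
noncomputable def doubleSchubert (w : SInf) : MvPolynomial ℕ (MvPolynomial ℕ ℤ) :=
  doubleSchubertAux (size w) w.1

/-- The single Schubert polynomial `𝔖_w(x) = 𝔖_w(x, 0) ∈ ℤ[x]`. -/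
noncomputable def schubert (w : SInf) : MvPolynomial ℕ ℤ :=
  MvPolynomial.map MvPolynomial.constantCoeff (doubleSchubert w)

end SchubertCalc

/-! Call the set of `ℤ_{≥0}[t]`-combinations of double Schubert polynomials the cone
(`schubertCone`). Each `∂_i` preserves it, because `∂_i` is linear over `ℤ[t]` and sends `𝔖_w` to
`𝔖_{w s_i}` or to `0` (`dividedDifference_mem`).

Since `v` has no descent before `k`, `𝔖_v(x,t)` is symmetric in `x_1, …, x_k`. If `u` has an ascent
`i < k`, then `𝔖_u = ∂_i 𝔖_{u s_i}`, and symmetry gives `𝔖_u 𝔖_v = ∂_i (𝔖_{u s_i} 𝔖_v)`. Hence `u`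
may be assumed decreasing on its first `k` positions; it increases afterwards, so it is dominant
(132-avoiding), and `𝔖_u(x)` is the monomial whose exponents are the Lehmer code, a partition
(`doubleSchubertAux_of_isDominant`).

Such a monomial is a product of factors `x_1 ⋯ x_m`, and each factor preserves the cone. The same
symmetry argument reduces `(x_1 ⋯ x_m) 𝔖_w` to `w` decreasing on its first `m` positions. There the
negative terms of the equivariant Monk formula for `x_m 𝔖_w` (`monkFormula`) vanish, and the
remaining permutations still decrease on the first `m - 1` positions, so the factors can be absorbed
one by one. -/

namespace SchubertCalc

open MvPolynomial Equiv

/-! ### Algebra of divided differences -/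

section DividedDifferenceLemmas

variable {R : Type*} [CommRing R]

theorem rename_swap_rename_swap (i j : ℕ) (f : MvPolynomial ℕ R) :
    rename (swap i j) (rename (swap i j) f) = f := by
  rw [rename_rename]
  convert rename_id_apply f
  ext x
  simp

theorem rename_swap_of_dividedDifference_eq_zero {i : ℕ} {f : MvPolynomial ℕ R}
    (h : dividedDifference i f = 0) : rename (swap i (i + 1)) f = f := by
  have := dividedDifference_spec i f
  rw [h, mul_zero] at this
  exact (sub_eq_zero.1 this).symm

theorem rename_swap_comm {i j : ℕ} (h : i + 1 < j) (f : MvPolynomial ℕ R) :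
    rename (swap i (i + 1)) (rename (swap j (j + 1)) f) =
      rename (swap j (j + 1)) (rename (swap i (i + 1)) f) := by
  rw [rename_rename, rename_rename]
  congr 2
  funext x
  simp only [Function.comp_apply, swap_apply_def]
  grind

theorem rename_swap_braid (i : ℕ) (f : MvPolynomial ℕ R) :
    rename (swap i (i + 1)) (rename (swap (i + 1) (i + 2)) (rename (swap i (i + 1)) f)) =
      rename (swap (i + 1) (i + 2)) (rename (swap i (i + 1)) (rename (swap (i + 1) (i + 2)) f)) := by
  simp only [rename_rename]
  congr 2
  funext x
  simp only [Function.comp_apply, swap_apply_def]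
  grind

variable [IsDomain R]

theorem X_sub_X_ne_zero {i j : ℕ} (h : i ≠ j) : (X i - X j : MvPolynomial ℕ R) ≠ 0 :=
  sub_ne_zero.2 fun e => h (X_injective e)

theorem dividedDifference_eq_of_mul {i : ℕ} {f g : MvPolynomial ℕ R}
    (h : f - rename (swap i (i + 1)) f = (X i - X (i + 1)) * g) : dividedDifference i f = g :=
  mul_left_cancel₀ (X_sub_X_ne_zero i.succ_ne_self.symm) ((dividedDifference_spec i f).symm.trans h)

theorem rename_swap_dividedDifference (i : ℕ) (f : MvPolynomial ℕ R) :
    rename (swap i (i + 1)) (dividedDifference i f) = dividedDifference i f := by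
  symm
  apply dividedDifference_eq_of_mul
  have h := congrArg (rename (swap i (i + 1))) (dividedDifference_spec i f)
  simp only [map_sub, map_mul, rename_swap_rename_swap, rename_X, swap_apply_left,
    swap_apply_right] at h
  linear_combination -h

theorem dividedDifference_add (i : ℕ) (f g : MvPolynomial ℕ R) :
    dividedDifference i (f + g) = dividedDifference i f + dividedDifference i g := by
  apply dividedDifference_eq_of_mul
  rw [map_add]
  linear_combination dividedDifference_spec i f + dividedDifference_spec i g

theorem dividedDifference_of_symm {i : ℕ} {f : MvPolynomial ℕ R}
    (h : rename (swap i (i + 1)) f = f) : dividedDifference i f = 0 :=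
  dividedDifference_eq_of_mul (by rw [h]; ring)

theorem dividedDifference_dividedDifference (i : ℕ) (f : MvPolynomial ℕ R) :
    dividedDifference i (dividedDifference i f) = 0 :=
  dividedDifference_of_symm (rename_swap_dividedDifference i f)

theorem dividedDifference_symm_mul {i : ℕ} {g : MvPolynomial ℕ R}
    (h : rename (swap i (i + 1)) g = g) (f : MvPolynomial ℕ R) :
    dividedDifference i (g * f) = g * dividedDifference i f := by
  apply dividedDifference_eq_of_mul
  rw [map_mul, h]
  linear_combination g * dividedDifference_spec i f

theorem dividedDifference_C_mul (i : ℕ) (a : R) (f : MvPolynomial ℕ R) :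
    dividedDifference i (C a * f) = C a * dividedDifference i f :=
  dividedDifference_symm_mul (rename_C _ a) f

/-- The divided difference operator as an additive map. -/
noncomputable def dividedDifferenceHom (i : ℕ) : MvPolynomial ℕ R →+ MvPolynomial ℕ R :=
  AddMonoidHom.mk' (dividedDifference i) (dividedDifference_add i)

theorem dividedDifferenceHom_apply (i : ℕ) (f : MvPolynomial ℕ R) :
    dividedDifferenceHom i f = dividedDifference i f := rfl

theorem dividedDifference_X_mul (i a : ℕ) (f : MvPolynomial ℕ R) :
    dividedDifference i (X a * f) = X (swap i (i + 1) a) * dividedDifference i f +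
      ((if a = i then f else 0) - (if a = i + 1 then f else 0)) := by
  apply dividedDifference_eq_of_mul
  have h := dividedDifference_spec i f
  rw [map_mul, rename_X]
  by_cases h1 : a = i
  · subst h1
    simp only [swap_apply_left, if_true, Nat.left_eq_add, one_ne_zero, if_false]
    linear_combination X (a + 1) * h
  · by_cases h2 : a = i + 1
    · subst h2
      simp only [swap_apply_right, if_true, Nat.add_eq_left, one_ne_zero, if_false]
      linear_combination X i * h
    · rw [swap_apply_of_ne_of_ne h1 h2, if_neg h1, if_neg h2]
      linear_combination X a * h

theorem dividedDifference_comm {i j : ℕ} (h : i + 1 < j) (f : MvPolynomial ℕ R) :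
    dividedDifference i (dividedDifference j f) = dividedDifference j (dividedDifference i f) := by
  have e1 : rename (swap i (i + 1)) (X j - X (j + 1) : MvPolynomial ℕ R) = X j - X (j + 1) := by
    rw [map_sub, rename_X, rename_X, swap_apply_of_ne_of_ne (by omega) (by omega),
      swap_apply_of_ne_of_ne (by omega) (by omega)]
  have e2 : rename (swap j (j + 1)) (X i - X (i + 1) : MvPolynomial ℕ R) = X i - X (i + 1) := by
    rw [map_sub, rename_X, rename_X, swap_apply_of_ne_of_ne (by omega) (by omega),
      swap_apply_of_ne_of_ne (by omega) (by omega)]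
  have h1 := dividedDifference_spec i (dividedDifference j f)
  have h2 := dividedDifference_spec j f
  have h3 := congrArg (rename (swap i (i + 1))) h2
  have k1 := dividedDifference_spec j (dividedDifference i f)
  have k2 := dividedDifference_spec i f
  have k3 := congrArg (rename (swap j (j + 1))) k2
  rw [map_mul, e1, map_sub, rename_swap_comm h] at h3
  rw [map_mul, e2, map_sub] at k3
  refine mul_left_cancel₀ (mul_ne_zero (X_sub_X_ne_zero (R := R) (i := i) (j := i + 1) (by omega))
    (X_sub_X_ne_zero (R := R) (i := j) (j := j + 1) (by omega))) ?_
  linear_combination (-(X j - X (j + 1))) * h1 - h2 + h3 + (X i - X (i + 1)) * k1 + k2 - k3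

/-- Multiplied by the Vandermonde product of the three variables, either side becomes the
alternating sum of `f` over the symmetric group on them. -/
theorem dividedDifference_braid (i : ℕ) (f : MvPolynomial ℕ R) :
    dividedDifference i (dividedDifference (i + 1) (dividedDifference i f)) =
      dividedDifference (i + 1) (dividedDifference i (dividedDifference (i + 1) f)) := by
  have s0 : swap i (i + 1) (i + 2) = i + 2 :=
    swap_apply_of_ne_of_ne (by omega) (by omega)
  have s1 : swap (i + 1) (i + 2) i = i :=
    swap_apply_of_ne_of_ne (by omega) (by omega)
  have a1 := dividedDifference_spec i f
  have a2 := dividedDifference_spec (i + 1) (dividedDifference i f)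
  have a3 := dividedDifference_spec i (dividedDifference (i + 1) (dividedDifference i f))
  have a4 := congrArg (rename (swap (i + 1) (i + 2))) a1
  have a5 := congrArg (rename (swap i (i + 1))) a4
  have a6 := congrArg (rename (swap i (i + 1))) a2
  have a7 := rename_swap_dividedDifference i f
  have b1 := dividedDifference_spec (i + 1) f
  have b2 := dividedDifference_spec i (dividedDifference (i + 1) f)
  have b3 := dividedDifference_spec (i + 1) (dividedDifference i (dividedDifference (i + 1) f))
  have b4 := congrArg (rename (swap i (i + 1))) b1
  have b5 := congrArg (rename (swap (i + 1) (i + 2))) b4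
  have b6 := congrArg (rename (swap (i + 1) (i + 2))) b2
  have b7 := rename_swap_dividedDifference (i + 1) f
  have br := rename_swap_braid i f
  simp only [map_sub, map_mul, rename_X, swap_apply_left, swap_apply_right, s0, s1,
    Nat.add_assoc, Nat.reduceAdd] at a1 a2 a3 a4 a5 a6 a7 b1 b2 b3 b4 b5 b6 b7 br
  have hA : (X i - X (i + 1)) * (X (i + 1) - X (i + 2)) * (X i - X (i + 2)) *
      dividedDifference i (dividedDifference (i + 1) (dividedDifference i f)) =
      f - rename (swap i (i + 1)) f - rename (swap (i + 1) (i + 2)) f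
      + rename (swap (i + 1) (i + 2)) (rename (swap i (i + 1)) f)
      + rename (swap i (i + 1)) (rename (swap (i + 1) (i + 2)) f)
      - rename (swap i (i + 1)) (rename (swap (i + 1) (i + 2)) (rename (swap i (i + 1)) f)) := by
    linear_combination (-(X (i + 1) - X (i + 2)) * (X i - X (i + 2))) * a3
      - (X i - X (i + 2)) * a2 - a1 + a4 - a5 + (X (i + 1) - X (i + 2)) * a6
      - (X (i + 1) - X (i + 2)) * a7
  have hB : (X i - X (i + 1)) * (X (i + 1) - X (i + 2)) * (X i - X (i + 2)) *
      dividedDifference (i + 1) (dividedDifference i (dividedDifference (i + 1) f)) =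
      f - rename (swap i (i + 1)) f - rename (swap (i + 1) (i + 2)) f
      + rename (swap (i + 1) (i + 2)) (rename (swap i (i + 1)) f)
      + rename (swap i (i + 1)) (rename (swap (i + 1) (i + 2)) f)
      - rename (swap (i + 1) (i + 2)) (rename (swap i (i + 1))
          (rename (swap (i + 1) (i + 2)) f)) := by
    linear_combination (-(X i - X (i + 1)) * (X i - X (i + 2))) * b3
      - (X i - X (i + 2)) * b2 - b1 + b4 - b5 + (X i - X (i + 1)) * b6
      - (X i - X (i + 1)) * b7
  refine mul_left_cancel₀ (mul_ne_zero (mul_ne_zero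
    (X_sub_X_ne_zero (R := R) (i := i) (j := i + 1) (by omega))
    (X_sub_X_ne_zero (R := R) (i := i + 1) (j := i + 2) (by omega)))
    (X_sub_X_ne_zero (R := R) (i := i) (j := i + 2) (by omega))) ?_
  rw [hA, hB, br]

end DividedDifferenceLemmas

theorem dividedDifference_map {R S : Type*} [CommRing R] [CommRing S] [IsDomain S] (φ : R →+* S) (i : ℕ)
    (f : MvPolynomial ℕ R) :
    dividedDifference i (map φ f) = map φ (dividedDifference i f) := by
  apply dividedDifference_eq_of_mul
  have h := congrArg (map φ) (dividedDifference_spec i f)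
  simpa only [map_sub, map_mul, map_X, map_rename] using h

/-! ### Independence of the ascent chosen in the recursion -/

theorem swap_mul_swap_comm {i j : ℕ} (h : i + 1 < j) :
    swap i (i + 1) * swap j (j + 1) = swap j (j + 1) * swap i (i + 1) := by
  ext x
  simp only [Perm.mul_apply, swap_apply_def]
  grind

theorem swap_mul_swap_braid (i : ℕ) :
    swap i (i + 1) * swap (i + 1) (i + 2) * swap i (i + 1) =
      swap (i + 1) (i + 2) * swap i (i + 1) * swap (i + 1) (i + 2) := by
  ext x
  simp only [Perm.mul_apply, swap_apply_def]
  grind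

theorem doubleSchubertAux_of_first_ascent {n : ℕ} {w : Perm ℕ} (h : (ascents n w).Nonempty) :
    doubleSchubertAux n w = dividedDifference (sInf (ascents n w))
      (doubleSchubertAux n (w * swap (sInf (ascents n w)) (sInf (ascents n w) + 1))) := by
  rw [doubleSchubertAux, dif_pos h]

/-- The given ascent is compared with the first one by climbing from `w` along both: distant ascents
meet after two steps by commutation, adjacent ones after three by the braid relation. The induction
hypothesis covers the permutations on the way. -/
theorem doubleSchubertAux_of_ascent {n : ℕ} {w : Perm ℕ} {i : ℕ} (hi : i ∈ ascents n w) :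
    doubleSchubertAux n w = dividedDifference i (doubleSchubertAux n (w * swap i (i + 1))) := by
  induction hm : ∑ j ∈ Finset.range n, j * w j using Nat.strong_induction_on generalizing w i with
  | _ m ih =>
  have key : ∀ {w' : Perm ℕ} {a : ℕ}, ∑ j ∈ Finset.range n, j * w' j < m → a ∈ ascents n w' →
      doubleSchubertAux n w' =
        dividedDifference a (doubleSchubertAux n (w' * swap a (a + 1))) :=
    fun hlt ha => ih _ hlt ha rfl
  rw [doubleSchubertAux_of_first_ascent ⟨i, hi⟩]
  have hj := Nat.sInf_mem ⟨i, hi⟩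
  have hle := Nat.sInf_le hi
  generalize sInf (ascents n w) = j at hj hle
  have wj := sum_mul_swap_lt w hj.1 hj.2
  have wi := sum_mul_swap_lt w hi.1 hi.2
  rw [hm] at wj wi
  obtain rfl | hlt := hle.eq_or_lt
  · rfl
  obtain rfl | hlt := (Nat.succ_le_of_lt hlt).eq_or_lt
  · obtain ⟨hj1, hj2⟩ := hj
    obtain ⟨hi1, hi2⟩ := hi
    have s0 : swap j (j + 1) (j + 2) = j + 2 := swap_apply_of_ne_of_ne (by omega) (by omega)
    have s1 : swap (j + 1) (j + 2) j = j := swap_apply_of_ne_of_ne (by omega) (by omega)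
    simp only [Nat.succ_eq_add_one, Nat.add_assoc, Nat.reduceAdd] at *
    have m1 : j + 1 ∈ ascents n (w * swap j (j + 1)) := by
      refine ⟨hi1, ?_⟩
      simp only [Perm.mul_apply, swap_apply_right, Nat.add_assoc, Nat.reduceAdd, s0]
      omega
    have m2 : j ∈ ascents n (w * swap j (j + 1) * swap (j + 1) (j + 2)) := by
      refine ⟨hj1, ?_⟩
      simp only [Perm.mul_apply, swap_apply_left, s0, s1]
      omega
    have m3 : j ∈ ascents n (w * swap (j + 1) (j + 2)) := by
      refine ⟨hj1, ?_⟩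
      simp only [Perm.mul_apply, swap_apply_left, s1]
      omega
    have m4 : j + 1 ∈ ascents n (w * swap (j + 1) (j + 2) * swap j (j + 1)) := by
      refine ⟨hi1, ?_⟩
      simp only [Perm.mul_apply, swap_apply_right, Nat.add_assoc, Nat.reduceAdd, s0, s1]
      omega
    have l1 := sum_mul_swap_lt _ m1.1 m1.2
    have l3 := sum_mul_swap_lt _ m3.1 m3.2
    simp only [Nat.add_assoc, Nat.reduceAdd] at l1 l3
    rw [key wj m1, key wi m3]
    simp only [Nat.add_assoc, Nat.reduceAdd]
    rw [key (l1.trans wj) m2, key (l3.trans wi) m4, dividedDifference_braid]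
    have := swap_mul_swap_braid j
    simp only [mul_assoc, Nat.add_assoc, Nat.reduceAdd] at this ⊢
    rw [this]
  · have hlt' : j + 1 < i := hlt
    have m1 : i ∈ ascents n (w * swap j (j + 1)) := by
      refine ⟨hi.1, ?_⟩
      rw [Perm.mul_apply, Perm.mul_apply, swap_apply_of_ne_of_ne (by omega) (by omega),
        swap_apply_of_ne_of_ne (by omega) (by omega)]
      exact hi.2
    have m2 : j ∈ ascents n (w * swap i (i + 1)) := by
      refine ⟨hj.1, ?_⟩
      rw [Perm.mul_apply, Perm.mul_apply, swap_apply_of_ne_of_ne (by omega) (by omega),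
        swap_apply_of_ne_of_ne (by omega) (by omega)]
      exact hj.2
    rw [key wj m1, key wi m2, dividedDifference_comm hlt', mul_assoc, mul_assoc,
      swap_mul_swap_comm hlt']

theorem dividedDifference_doubleSchubertAux_of_ascent {n : ℕ} {w : Perm ℕ} {i : ℕ}
    (hi : i + 1 < n) (h : w i < w (i + 1)) : dividedDifference i (doubleSchubertAux n w) = 0 := by
  rw [doubleSchubertAux_of_ascent ⟨hi, h⟩, dividedDifference_dividedDifference]

theorem dividedDifference_doubleSchubertAux_of_descent {n : ℕ} {w : Perm ℕ} {i : ℕ}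
    (hi : i + 1 < n) (h : w (i + 1) < w i) :
    dividedDifference i (doubleSchubertAux n w) = doubleSchubertAux n (w * swap i (i + 1)) := by
  have : i ∈ ascents n (w * swap i (i + 1)) := ⟨hi, by simpa using h⟩
  rw [doubleSchubertAux_of_ascent this, mul_assoc, swap_mul_self, mul_one]

/-! ### Dominant permutations and their product formula -/

/-- Permutations avoiding the pattern `132` (the dominant permutations). -/
def IsDominant (w : Perm ℕ) : Prop :=
  ∀ a b c, a < b → b < c → w a < w c → w b < w c

/-- The `a`-th entry of the Lehmer code of `w`, counting only positions below `n`. -/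
def code (n : ℕ) (w : Perm ℕ) (a : ℕ) : ℕ :=
  ((Finset.range n).filter fun j => a < j ∧ w j < w a).card

theorem anti_of_no_ascent {m : ℕ} {w : Perm ℕ} (h : ∀ i, i + 1 < m → w (i + 1) < w i) :
    ∀ a b, a < b → b < m → w b < w a := by
  intro a b hab
  induction b, hab using Nat.le_induction with
  | base => exact h a
  | succ b hab ih => exact fun hb => (h b hb).trans (ih (by omega))

theorem not_mem_ascents {n i : ℕ} {w : Perm ℕ} (h : i ∉ ascents n w) (hi : i + 1 < n) :
    w (i + 1) < w i := by
  have h1 : ¬ w i < w (i + 1) := fun e => h ⟨hi, e⟩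
  have h2 : w i ≠ w (i + 1) := fun e => by simpa using w.injective e
  omega

theorem anti_of_ascents_eq_empty {n : ℕ} {w : Perm ℕ} (h : ¬ (ascents n w).Nonempty) :
    ∀ a b, a < b → b < n → w b < w a :=
  anti_of_no_ascent fun i hi => not_mem_ascents (fun e => h ⟨i, e⟩) hi

theorem code_of_anti {n : ℕ} {w : Perm ℕ} (h : ∀ a b, a < b → b < n → w b < w a) (a : ℕ) :
    code n w a = n - 1 - a := by
  have : (Finset.range n).filter (fun j => a < j ∧ w j < w a) = Finset.Ioo a n := by
    ext j
    simp only [Finset.mem_filter, Finset.mem_range, Finset.mem_Ioo]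
    exact ⟨fun e => ⟨e.2.1, e.1⟩, fun e => ⟨e.2, e.1, h a j e.1 e.2⟩⟩
  rw [code, this, Nat.card_Ioo]
  omega

/-- The only new 132 pattern that could arise uses `i` and `i + 1` as its last two positions, and
`ha` forbids a smaller letter before them. The first ascent satisfies `ha`. -/
theorem IsDominant.mul_swap {w : Perm ℕ} (hw : IsDominant w) {i : ℕ} (hi : w i < w (i + 1))
    (ha : ∀ a, a < i → w i < w a) : IsDominant (w * swap i (i + 1)) := by
  intro a b c hab hbc hac
  simp only [Perm.mul_apply] at hac ⊢
  rcases lt_or_ge (swap i (i + 1) a) (swap i (i + 1) b) with h1 | h1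
  · rcases lt_or_ge (swap i (i + 1) b) (swap i (i + 1) c) with h2 | h2
    · exact hw _ _ _ h1 h2 hac
    · have e : b = i ∧ c = i + 1 := by simp only [swap_apply_def] at h2; grind
      obtain ⟨rfl, rfl⟩ := e
      rw [swap_apply_right, swap_apply_of_ne_of_ne (by omega) (by omega)] at hac
      exact absurd (ha a hab) (by omega)
  · have e : a = i ∧ b = i + 1 := by simp only [swap_apply_def] at h1; grind
    obtain ⟨rfl, rfl⟩ := e
    rw [swap_apply_left] at hac
    rw [swap_apply_right]
    omega

/-- A later letter strictly between `w i` and `w (i + 1)` would complete a 132 pattern. -/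
theorem IsDominant.code_succ {w : Perm ℕ} (hw : IsDominant w) {i : ℕ} (hi : w i < w (i + 1))
    (n : ℕ) : code n w (i + 1) = code n w i := by
  unfold code
  congr 1
  ext j
  simp only [Finset.mem_filter, Finset.mem_range]
  refine and_congr_right fun _ => ⟨fun h => ?_, fun h => ?_⟩
  · refine ⟨by omega, ?_⟩
    by_contra h'
    have hne : w i ≠ w j := fun e => by have := w.injective e; omega
    have := hw i (i + 1) j (by omega) h.1 (by omega)
    omega
  · have hne : j ≠ i + 1 := by rintro rfl; omega
    exact ⟨by omega, by omega⟩

theorem IsDominant.code_mul_swap {w : Perm ℕ} (hw : IsDominant w) {n i : ℕ} (hn : i + 1 < n)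
    (hi : w i < w (i + 1)) (a : ℕ) :
    code n (w * swap i (i + 1)) a = code n w a + if a = i then 1 else 0 := by
  by_cases h1 : a = i
  · subst h1
    have : (Finset.range n).filter
        (fun j => a < j ∧ (w * swap a (a + 1)) j < (w * swap a (a + 1)) a) =
        insert (a + 1) ((Finset.range n).filter fun j => a + 1 < j ∧ w j < w (a + 1)) := by
      ext j
      simp only [Finset.mem_filter, Finset.mem_range, Finset.mem_insert, Perm.mul_apply,
        swap_apply_left]
      by_cases hj : j = a + 1
      · subst hj; simp [hn, hi]
      · by_cases hj' : a < j
        · rw [swap_apply_of_ne_of_ne (by omega) hj]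
          constructor
          · exact fun h => Or.inr ⟨h.1, by omega, h.2.2⟩
          · exact fun h => (h.resolve_left hj).imp_right fun h => ⟨hj', h.2⟩
        · constructor
          · exact fun h => absurd h.2.1 hj'
          · intro h
            have := (h.resolve_left hj).2.1
            omega
    rw [if_pos rfl, ← hw.code_succ hi n]
    unfold code
    rw [this, Finset.card_insert_of_notMem (by simp)]
  · rw [if_neg h1, add_zero]
    by_cases h2 : a = i + 1
    · subst h2
      rw [hw.code_succ hi n]
      unfold code
      congr 1
      ext j
      simp only [Finset.mem_filter, Finset.mem_range, Perm.mul_apply, swap_apply_right]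
      refine and_congr_right fun _ => ?_
      by_cases hj : j = i + 1
      · subst hj; simp; omega
      · by_cases hj' : i + 1 < j
        · rw [swap_apply_of_ne_of_ne (by omega) hj]
          exact ⟨fun h => ⟨by omega, h.2⟩, fun h => ⟨by omega, h.2⟩⟩
        · exact ⟨fun h => absurd h.1 hj', fun h => by omega⟩
    · unfold code
      refine Finset.card_bij' (fun j _ => swap i (i + 1) j) (fun j _ => swap i (i + 1) j)
        ?_ ?_ (by simp) (by simp)
      · intro j hj
        simp only [Finset.mem_filter, Finset.mem_range, Perm.mul_apply,
          swap_apply_of_ne_of_ne h1 h2] at hj ⊢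
        refine ⟨?_, ?_, hj.2.2⟩ <;> simp only [swap_apply_def] <;> grind
      · intro j hj
        simp only [Finset.mem_filter, Finset.mem_range, Perm.mul_apply,
          swap_apply_of_ne_of_ne h1 h2, swap_apply_self] at hj ⊢
        refine ⟨?_, ?_, hj.2.2⟩ <;> simp only [swap_apply_def] <;> grind

/-- The product `∏_{a < n} ∏_{j < c a} (x_a - t_j)`. -/
noncomputable def diagramProd (n : ℕ) (c : ℕ → ℕ) : MvPolynomial ℕ (MvPolynomial ℕ ℤ) :=
  ∏ a ∈ Finset.range n, ∏ j ∈ Finset.range (c a), (X a - C (X j))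

theorem diagramProd_congr {n : ℕ} {c d : ℕ → ℕ} (h : ∀ a, a < n → c a = d a) :
    diagramProd n c = diagramProd n d :=
  Finset.prod_congr rfl fun a ha => by rw [h a (Finset.mem_range.1 ha)]

theorem diagramProd_add_box {n i : ℕ} (hi : i < n) (c : ℕ → ℕ) :
    diagramProd n (fun a => c a + if a = i then 1 else 0) =
      (X i - C (X (c i))) * diagramProd n c := by
  unfold diagramProd
  rw [← Finset.mul_prod_erase _ _ (Finset.mem_range.2 hi),
    ← Finset.mul_prod_erase (Finset.range n)
      (fun a => ∏ j ∈ Finset.range (c a), (X a - C (X j))) (Finset.mem_range.2 hi)]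
  have e : ∏ a ∈ (Finset.range n).erase i, ∏ j ∈ Finset.range (c a + if a = i then 1 else 0),
      (X a - C (X j) : MvPolynomial ℕ (MvPolynomial ℕ ℤ)) =
      ∏ a ∈ (Finset.range n).erase i, ∏ j ∈ Finset.range (c a), (X a - C (X j)) :=
    Finset.prod_congr rfl fun a ha => by rw [if_neg (Finset.ne_of_mem_erase ha), add_zero]
  rw [e]
  dsimp only
  rw [if_pos rfl, Finset.prod_range_succ, mul_comm _ (X i - C (X (c i))), mul_assoc]

theorem rename_swap_diagramProd {n i : ℕ} (hi : i + 1 < n) {c : ℕ → ℕ} (hc : c (i + 1) = c i) :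
    rename (swap i (i + 1)) (diagramProd n c) = diagramProd n c := by
  unfold diagramProd
  simp only [map_prod, map_sub, rename_X, rename_C]
  refine Finset.prod_bij' (fun a _ => swap i (i + 1) a) (fun a _ => swap i (i + 1) a)
    ?_ ?_ (by simp) (by simp) ?_
  · intro a ha
    simp only [Finset.mem_range, swap_apply_def] at ha ⊢
    grind
  · intro a ha
    simp only [Finset.mem_range, swap_apply_def] at ha ⊢
    grind
  · intro a _
    have : c (swap i (i + 1) a) = c a := by
      simp only [swap_apply_def]
      grind
    rw [this]

/-- Swapping at the first ascent `i` stays dominant and adds one box to row `i` of the diagram. Rows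
`i` and `i + 1` of `w` have equal length, so the product for `w` is symmetric in the two variables
and `∂_i` turns the extra linear factor into `1`. -/
theorem doubleSchubertAux_of_isDominant {n : ℕ} {w : Perm ℕ} (hw : IsDominant w) :
    doubleSchubertAux n w = diagramProd n (code n w) := by
  induction hm : ∑ j ∈ Finset.range n, j * w j using Nat.strong_induction_on generalizing w with
  | _ m ih =>
  by_cases h : (ascents n w).Nonempty
  · have hj := Nat.sInf_mem h
    have hlt : ∀ a, a < sInf (ascents n w) → w (a + 1) < w a := fun a ha =>
      not_mem_ascents (Nat.notMem_of_lt_sInf ha) (by have := hj.1; omega)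
    rw [doubleSchubertAux_of_first_ascent h]
    generalize sInf (ascents n w) = i at hj hlt
    obtain ⟨hn, hi⟩ := hj
    have ha : ∀ a, a < i → w i < w a := fun a ha =>
      anti_of_no_ascent (m := i + 1) (fun a h => hlt a (by omega)) a i ha (by omega)
    rw [ih _ (hm ▸ sum_mul_swap_lt w hn hi) (hw.mul_swap hi ha) rfl,
      diagramProd_congr fun a _ => hw.code_mul_swap hn hi a, diagramProd_add_box (by omega),
      mul_comm, dividedDifference_symm_mul (rename_swap_diagramProd hn (hw.code_succ hi n))]
    have : dividedDifference i (X i - C (X (code n w i)) : MvPolynomial ℕ (MvPolynomial ℕ ℤ)) = 1 :=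
      dividedDifference_eq_of_mul (by simp)
    rw [this, mul_one]
  · rw [doubleSchubertAux, dif_neg h,
      diagramProd_congr fun a _ => code_of_anti (anti_of_ascents_eq_empty h) a, diagramProd,
      Finset.prod_sigma']
    refine Finset.prod_bij' (fun p _ => ⟨p.1, p.2⟩) (fun p _ => (p.1, p.2)) ?_ ?_ (by simp)
      (by simp) (by simp)
    · intro p hp
      simp only [Finset.mem_filter, Finset.mem_product, Finset.mem_range, Finset.mem_sigma] at hp ⊢
      omega
    · intro p hp
      simp only [Finset.mem_filter, Finset.mem_product, Finset.mem_range, Finset.mem_sigma] at hp ⊢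
      omega

/-! ### Stability under `S_n ⊂ S_{n+1}` -/

theorem apply_lt_of_fix {n : ℕ} {w : Perm ℕ} (hf : ∀ i, n ≤ i → w i = i) {x : ℕ} (hx : x < n) :
    w x < n := by
  by_contra h'
  have := w.injective (hf (w x) (by omega))
  omega

theorem isDominant_of_anti_of_fix {n : ℕ} {w : Perm ℕ} (h : ∀ a b, a < b → b < n → w b < w a)
    (hf : ∀ i, n ≤ i → w i = i) : IsDominant w := by
  intro a b c hab hbc hac
  by_cases hc : c < n
  · have := h a c (by omega) hc
    omega
  · rw [hf c (by omega)]
    by_cases hb : b < n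
    · have := apply_lt_of_fix hf hb
      omega
    · rw [hf b (by omega)]
      exact hbc

theorem fix_mul_swap {n : ℕ} {w : Perm ℕ} (hf : ∀ i, n ≤ i → w i = i) {a b : ℕ} (ha : a < n)
    (hb : b < n) : ∀ i, n ≤ i → (w * swap a b) i = i := fun i hi => by
  rw [Perm.mul_apply, swap_apply_of_ne_of_ne (by omega) (by omega), hf i hi]

theorem code_succ_of_fix {n : ℕ} {w : Perm ℕ} (hf : ∀ i, n ≤ i → w i = i) {a : ℕ} (ha : a < n) :
    code (n + 1) w a = code n w a := by
  have := apply_lt_of_fix hf ha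
  rw [code, code, Finset.range_add_one, Finset.filter_insert, if_neg]
  rw [hf n le_rfl]
  omega

/-- Ascents below `n` give the same recursion on both sides. It ends at the longest element of
`S_n`, which is dominant, and the larger window only adds an empty row to its diagram. -/
theorem doubleSchubertAux_succ {n : ℕ} {w : Perm ℕ} (hf : ∀ i, n ≤ i → w i = i) :
    doubleSchubertAux (n + 1) w = doubleSchubertAux n w := by
  induction hm : ∑ j ∈ Finset.range n, j * w j using Nat.strong_induction_on generalizing w with
  | _ m ih =>
  by_cases h : (ascents n w).Nonempty
  · obtain ⟨i, hi⟩ := h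
    have hi' : i ∈ ascents (n + 1) w := ⟨hi.1.trans n.lt_succ_self, hi.2⟩
    rw [doubleSchubertAux_of_ascent hi, doubleSchubertAux_of_ascent hi',
      ih _ (hm ▸ sum_mul_swap_lt w hi.1 hi.2)
        (fix_mul_swap hf ((Nat.lt_succ_self i).trans hi.1) hi.1) rfl]
  · have hd := isDominant_of_anti_of_fix (anti_of_ascents_eq_empty h) hf
    have h0 : code (n + 1) w n = 0 := by
      rw [code, Finset.card_eq_zero, Finset.filter_eq_empty_iff]
      intro j hj
      have := Finset.mem_range.1 hj
      omega
    rw [doubleSchubertAux_of_isDominant hd, doubleSchubertAux_of_isDominant hd, diagramProd,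
      Finset.prod_range_succ, h0, Finset.prod_range_zero, mul_one]
    exact diagramProd_congr fun a ha => code_succ_of_fix hf ha

theorem doubleSchubertAux_eq_of_le {m n : ℕ} (hmn : m ≤ n) {w : Perm ℕ}
    (hf : ∀ i, m ≤ i → w i = i) : doubleSchubertAux n w = doubleSchubertAux m w := by
  induction n, hmn using Nat.le_induction with
  | base => rfl
  | succ n hmn ih => rw [doubleSchubertAux_succ fun i hi => hf i (hmn.trans hi), ih]

theorem exists_fix (w : SInf) : ∃ n, ∀ i, n ≤ i → w.1 i = i := by
  obtain ⟨b, hb⟩ := Set.Finite.bddAbove (show {i | w.1 i ≠ i}.Finite from w.2)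
  refine ⟨b + 1, fun i hi => ?_⟩
  by_contra h
  have : i ≤ b := hb h
  omega

theorem doubleSchubert_eq {w : SInf} {n : ℕ} (hf : ∀ i, n ≤ i → w.1 i = i) :
    doubleSchubert w = doubleSchubertAux n w.1 :=
  (doubleSchubertAux_eq_of_le (Nat.sInf_le (s := {n | ∀ i, n ≤ i → w.1 i = i}) hf)
    (Nat.sInf_mem (s := {n | ∀ i, n ≤ i → w.1 i = i}) ⟨n, hf⟩)).symm

/-! ### The equivariant Monk formula -/

/-- The transposition of the positions `a < b` of `w` increases the length of `w` by one. -/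
def IsCover (w : Perm ℕ) (a b : ℕ) : Prop :=
  a < b ∧ w a < w b ∧ ∀ c, a < c → c < b → ¬ (w a < w c ∧ w c < w b)

theorem isCover_mul_swap_iff {w : Perm ℕ} {r : ℕ} (hr : w (r + 1) < w r) (a b : ℕ) :
    (IsCover (w * swap r (r + 1)) (swap r (r + 1) a) (swap r (r + 1) b) ∧
        ¬ (swap r (r + 1) a = r ∧ swap r (r + 1) b = r + 1)) ↔
      IsCover w a b ∧ (w * swap a b) (r + 1) < (w * swap a b) r := by
  have key : IsCover (w * swap r (r + 1)) (swap r (r + 1) a) (swap r (r + 1) b) ↔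
      swap r (r + 1) a < swap r (r + 1) b ∧ w a < w b ∧
        ∀ c, swap r (r + 1) a < swap r (r + 1) c → swap r (r + 1) c < swap r (r + 1) b →
          ¬ (w a < w c ∧ w c < w b) := by
    unfold IsCover
    simp only [Perm.mul_apply, swap_apply_self]
    refine and_congr_right fun _ => and_congr_right fun _ => ⟨fun h c => ?_, fun h c => ?_⟩
    · simpa using h (swap r (r + 1) c)
    · simpa using h (swap r (r + 1) c)
  rw [key]
  have i1 : w b = w r → b = r := fun e => w.injective e
  have i2 : w b = w (r + 1) → b = r + 1 := fun e => w.injective e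
  have i3 : w a = w r → a = r := fun e => w.injective e
  have i4 : w a = w (r + 1) → a = r + 1 := fun e => w.injective e
  clear key
  unfold IsCover
  simp only [Perm.mul_apply, swap_apply_def]
  constructor
  · rintro ⟨⟨h1, h2, h3⟩, h4⟩
    -- Only `r` and `r + 1` change their relative order, so the betweenness condition has to be
    -- examined at these two positions besides the generic `c`.
    have e1 := h3 r
    have e2 := h3 (r + 1)
    refine ⟨⟨by clear h3; grind, h2, fun c hc hc' => ?_⟩, by clear h3; grind⟩
    have := h3 c
    clear h3
    grind
  · rintro ⟨⟨h1, h2, h3⟩, h4⟩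
    have e1 := h3 r
    have e2 := h3 (r + 1)
    refine ⟨⟨by clear h3; grind, h2, fun c hc hc' => ?_⟩, by clear h3; grind⟩
    have := h3 c
    clear h3
    grind

open Classical in
/-- The contribution of the transposition of the positions `a < b` to Monk's formula for `w`. -/
noncomputable def monkTerm (n : ℕ) (w : Perm ℕ) (a b : ℕ) : MvPolynomial ℕ (MvPolynomial ℕ ℤ) :=
  if IsCover w a b then doubleSchubertAux n (w * swap a b) else 0

/-- Covers of `w` that keep the descent at `r` match covers of `w s_r`; the others are killed by
`∂_r`. The one unmatched cover of `w s_r` is the step back up to `w`, hence the correction. -/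
theorem dividedDifference_monkTerm {n r : ℕ} {w : Perm ℕ} (hn : r + 1 < n)
    (hr : w (r + 1) < w r) (a b : ℕ) :
    dividedDifference r (monkTerm n w a b) =
      monkTerm n (w * swap r (r + 1)) (swap r (r + 1) a) (swap r (r + 1) b) -
        if swap r (r + 1) a = r ∧ swap r (r + 1) b = r + 1 then doubleSchubertAux n w else 0 := by
  have hiff := isCover_mul_swap_iff hr a b
  have hconj : w * swap r (r + 1) * swap (swap r (r + 1) a) (swap r (r + 1) b) =
      w * swap a b * swap r (r + 1) := by
    rw [mul_assoc, mul_assoc, Equiv.mul_swap_eq_swap_mul]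
    simp
  unfold monkTerm
  by_cases h : swap r (r + 1) a = r ∧ swap r (r + 1) b = r + 1
  · have hab : a = r + 1 ∧ b = r := by
      have h1 := congrArg (swap r (r + 1)) h.1
      have h2 := congrArg (swap r (r + 1)) h.2
      simpa using And.intro h1 h2
    have hc : IsCover (w * swap r (r + 1)) r (r + 1) := by
      refine ⟨r.lt_succ_self, by simpa using hr, fun c h1 h2 => by omega⟩
    have hc' : ¬ IsCover w a b := fun e => by have := e.1; omega
    rw [if_neg hc', if_pos h, h.1, h.2, if_pos hc, mul_assoc, swap_mul_self, mul_one, sub_self,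
      dividedDifference_of_symm (map_zero _)]
  · rw [if_neg h, sub_zero, hconj]
    by_cases hc : IsCover w a b
    · rw [if_pos hc]
      by_cases hd : (w * swap a b) (r + 1) < (w * swap a b) r
      · rw [if_pos (hiff.2 ⟨hc, hd⟩).1, dividedDifference_doubleSchubertAux_of_descent hn hd]
      · have hne : (w * swap a b) r ≠ (w * swap a b) (r + 1) := fun e => by
          simpa using (w * swap a b).injective e
        rw [if_neg fun e => hd (hiff.1 ⟨e, h⟩).2,
          dividedDifference_doubleSchubertAux_of_ascent hn (by omega)]
    · rw [if_neg hc, if_neg fun e => hc (hiff.1 ⟨e, h⟩).1, dividedDifference_of_symm (map_zero _)]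

theorem sum_swap {M : Type*} [AddCommMonoid M] {n r : ℕ} (hn : r + 1 < n) (f : ℕ → M) :
    ∑ j ∈ Finset.range n, f (swap r (r + 1) j) = ∑ j ∈ Finset.range n, f j := by
  refine Finset.sum_bij' (fun a _ => swap r (r + 1) a) (fun a _ => swap r (r + 1) a)
    ?_ ?_ (by simp) (by simp) (by simp) <;>
  · intro a ha
    simp only [Finset.mem_range, swap_apply_def] at ha ⊢
    grind

/-- The equivariant Monk formula for multiplication by `x_i`, for a permutation whose letters below
`n` are permuted among themselves. -/
def MonkFormula (n : ℕ) (w : Perm ℕ) (i : ℕ) : Prop :=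
  X i * doubleSchubertAux n w = C (X (w i)) * doubleSchubertAux n w +
    ∑ j ∈ Finset.range n, monkTerm n w i j - ∑ j ∈ Finset.range n, monkTerm n w j i

/-- Apply `∂_r`: the terms `± 𝔖_w` from the twisted Leibniz rule for `x_i` are exactly the covers
from `w s_r` to `w` missing from the two sums. -/
theorem MonkFormula.mul_swap {n r : ℕ} {w : Perm ℕ} (hn : r + 1 < n) (hr : w (r + 1) < w r)
    {i : ℕ} (h : MonkFormula n w (swap r (r + 1) i)) :
    MonkFormula n (w * swap r (r + 1)) i := by
  unfold MonkFormula at h ⊢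
  have h' := congrArg (dividedDifferenceHom r) h
  simp only [map_add, map_sub, map_sum] at h'
  simp only [dividedDifferenceHom_apply, dividedDifference_X_mul, dividedDifference_C_mul,
    dividedDifference_monkTerm hn hr, swap_apply_self,
    dividedDifference_doubleSchubertAux_of_descent hn hr, Finset.sum_sub_distrib] at h'
  rw [sum_swap hn (fun j => monkTerm n (w * swap r (r + 1)) i j),
    sum_swap hn (fun j => monkTerm n (w * swap r (r + 1)) j i),
    sum_swap hn (fun j => if i = r ∧ j = r + 1 then doubleSchubertAux n w else 0),
    sum_swap hn (fun j => if j = r ∧ i = r + 1 then doubleSchubertAux n w else 0)] at h'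
  have e1 : ∑ j ∈ Finset.range n, (if i = r ∧ j = r + 1 then doubleSchubertAux n w else 0) =
      if i = r then doubleSchubertAux n w else 0 := by
    by_cases hi : i = r
    · simp [hi, hn]
    · simp [hi]
  have e2 : ∑ j ∈ Finset.range n, (if j = r ∧ i = r + 1 then doubleSchubertAux n w else 0) =
      if i = r + 1 then doubleSchubertAux n w else 0 := by
    by_cases hi : i = r + 1
    · simp [hi, (Nat.lt_succ_self r).trans hn]
    · simp [hi]
  have e3 : swap r (r + 1) i = r ↔ i = r + 1 := by
    rw [swap_apply_eq_iff, swap_apply_left]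
  have e4 : swap r (r + 1) i = r + 1 ↔ i = r := by
    rw [swap_apply_eq_iff, swap_apply_right]
  rw [e1, e2] at h'
  simp only [e3, e4] at h'
  rw [Perm.mul_apply]
  linear_combination h'

theorem apply_eq_of_anti {N : ℕ} {w : Perm ℕ} (ha : ∀ a b, a < b → b < N → w b < w a)
    (hf : ∀ i, N ≤ i → w i = i) : ∀ a, a < N → w a = N - 1 - a := by
  have h1 : ∀ a, a < N → w a + a < N := by
    intro a
    induction a with
    | zero => exact fun h => apply_lt_of_fix hf h
    | succ a ih => exact fun h => by have := ih (by omega); have := ha a (a + 1) (by omega) h; omega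
  -- The lower bound mirrors `h1`, counting positions from the right end; together they pin down
  -- `w`.
  have h2 : ∀ b, b < N → b ≤ w (N - 1 - b) := by
    intro b
    induction b with
    | zero => exact fun _ => Nat.zero_le _
    | succ b ih =>
      intro h
      have := ih (by omega)
      have := ha (N - 1 - (b + 1)) (N - 1 - b) (by omega) (by omega)
      omega
  intro a h
  have e1 := h1 a h
  have e2 := h2 (N - 1 - a) (by omega)
  rw [show N - 1 - (N - 1 - a) = a by omega] at e2
  omega

/-- For the longest element of `S_N` the only cover at `i` exchanges it with the fixed position `N`,
whence the window `N + 1`. The result is dominant with one more box in row `i`, contributing the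
factor `x_i - t_{w(i)}`. -/
theorem monkFormula_of_anti {N : ℕ} {w : Perm ℕ} (ha : ∀ a b, a < b → b < N → w b < w a)
    (hf : ∀ i, N ≤ i → w i = i) {i : ℕ} (hi : i < N) : MonkFormula (N + 1) w i := by
  have hval := apply_eq_of_anti ha hf
  have hN := hf N le_rfl
  have hcov : ∀ j, j < N + 1 → (IsCover w i j ↔ j = N) := by
    intro j hj
    constructor
    · intro h
      by_contra hne
      have := ha i j h.1 (by omega)
      have := h.2.1
      omega
    · rintro rfl
      refine ⟨hi, by rw [hN]; exact apply_lt_of_fix hf hi, fun c h1 h2 h => ?_⟩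
      have := ha i c h1 h2
      omega
  have hcov' : ∀ j, ¬ IsCover w j i := fun j h => by
    have := ha j i h.1 hi
    have := h.2.1
    omega
  have s1 : ∑ j ∈ Finset.range (N + 1), monkTerm (N + 1) w i j =
      doubleSchubertAux (N + 1) (w * swap i N) := by
    rw [Finset.sum_eq_single N]
    · rw [monkTerm, if_pos ((hcov N N.lt_succ_self).2 rfl)]
    · intro j hj hne
      rw [monkTerm, if_neg fun e => hne ((hcov j (Finset.mem_range.1 hj)).1 e)]
    · simp
  have s2 : ∑ j ∈ Finset.range (N + 1), monkTerm (N + 1) w j i = 0 :=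
    Finset.sum_eq_zero fun j _ => by rw [monkTerm, if_neg (hcov' j)]
  have v : ∀ x, (w * swap i N) x = if x = i then N else if x = N then N - 1 - i else w x := by
    intro x
    rw [Perm.mul_apply, swap_apply_def]
    split_ifs with h1 h2
    · exact hN
    · exact hval i hi
    · rfl
  have d : IsDominant (w * swap i N) := by
    intro a b c hab hbc
    rw [v, v, v]
    have := hval a
    have := hval b
    have := hval c
    have := hf a
    have := hf b
    have := hf c
    clear ha hf hval hcov hcov' s1 s2 v
    split_ifs <;> omega
  have cw : ∀ a, a < N + 1 → code (N + 1) w a = N - 1 - a := by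
    intro a haN
    by_cases h : a < N
    · rw [code_succ_of_fix hf h, code_of_anti ha]
    · have : a = N := by omega
      subst this
      rw [code, show a - 1 - a = 0 by omega, Finset.card_eq_zero, Finset.filter_eq_empty_iff]
      intro j hj
      have := Finset.mem_range.1 hj
      omega
  have cw' : ∀ a, a < N + 1 →
      code (N + 1) (w * swap i N) a = N - 1 - a + if a = i then 1 else 0 := by
    intro a haN
    rcases lt_trichotomy a i with h | h | h
    · have : (Finset.range (N + 1)).filter
          (fun j => a < j ∧ (w * swap i N) j < (w * swap i N) a) = (Finset.Ioc a N).erase i := by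
        ext j
        simp only [Finset.mem_filter, Finset.mem_range, Finset.mem_erase, Finset.mem_Ioc]
        rw [v, v]
        have := hval a
        have := hval j
        clear ha hf hval hcov hcov' s1 s2 v d cw
        split_ifs <;> omega
      rw [code, this, Finset.card_erase_of_mem (Finset.mem_Ioc.2 ⟨h, hi.le⟩), Nat.card_Ioc,
        if_neg (by omega)]
      omega
    · subst h
      have : (Finset.range (N + 1)).filter
          (fun j => a < j ∧ (w * swap a N) j < (w * swap a N) a) = Finset.Ioc a N := by
        ext j
        simp only [Finset.mem_filter, Finset.mem_range, Finset.mem_Ioc]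
        rw [v, v]
        have := hval j
        clear ha hf hval hcov hcov' s1 s2 v d cw
        split_ifs <;> omega
      rw [code, this, Nat.card_Ioc, if_pos rfl]
      omega
    · have : (Finset.range (N + 1)).filter
          (fun j => a < j ∧ (w * swap i N) j < (w * swap i N) a) = Finset.Ioo a N := by
        ext j
        simp only [Finset.mem_filter, Finset.mem_range, Finset.mem_Ioo]
        rw [v, v]
        have := hval a
        have := hval j
        clear ha hf hval hcov hcov' s1 s2 v d cw
        split_ifs <;> omega
      rw [code, this, Nat.card_Ioo, if_neg (by omega)]
      omega
  rw [MonkFormula, s1, s2, sub_zero, doubleSchubertAux_of_isDominant d,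
    doubleSchubertAux_of_isDominant (isDominant_of_anti_of_fix ha hf), diagramProd_congr cw,
    diagramProd_congr cw', diagramProd_add_box (by omega), hval i hi]
  ring

theorem monkFormula {N : ℕ} {w : Perm ℕ} (hf : ∀ i, N ≤ i → w i = i) {i : ℕ} (hi : i < N) :
    MonkFormula (N + 1) w i := by
  induction hm : ∑ j ∈ Finset.range N, j * w j using Nat.strong_induction_on generalizing w i with
  | _ m ih =>
  by_cases h : (ascents N w).Nonempty
  · obtain ⟨r, hr⟩ := h
    have hlt := sum_mul_swap_lt w hr.1 hr.2
    have hr' : r + 1 < N + 1 := hr.1.trans N.lt_succ_self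
    have hs : swap r (r + 1) i < N := by
      have := hr.1
      rw [swap_apply_def]
      split_ifs <;> omega
    have := (ih _ (hm ▸ hlt) (fix_mul_swap hf ((Nat.lt_succ_self r).trans hr.1) hr.1) hs
      rfl).mul_swap hr' (by simpa using hr.2)
    rwa [mul_assoc, swap_mul_self, mul_one] at this
  · exact monkFormula_of_anti (anti_of_ascents_eq_empty h) hf hi

/-! ### Passage to `S_∞` and the cone of nonnegative combinations -/

/-- The transposition of two letters, as an element of `S_∞`. -/
def swapInf (a b : ℕ) : SInf :=
  ⟨swap a b, (Set.toFinite {a, b}).subset fun x hx => by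
    by_contra h
    simp only [Set.mem_insert_iff, Set.mem_singleton_iff, not_or] at h
    exact hx (swap_apply_of_ne_of_ne h.1 h.2)⟩

theorem coe_mul_swapInf (w : SInf) (a b : ℕ) : (w * swapInf a b).1 = w.1 * swap a b := rfl

theorem exists_fix_gt (w : SInf) (m : ℕ) : ∃ n, m < n ∧ ∀ i, n ≤ i → w.1 i = i := by
  obtain ⟨n, hn⟩ := exists_fix w
  exact ⟨m + 1 + n, by omega, fun i hi => hn i (by omega)⟩

theorem dividedDifference_doubleSchubert_of_ascent {w : SInf} {i : ℕ} (h : w.1 i < w.1 (i + 1)) :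
    dividedDifference i (doubleSchubert w) = 0 := by
  obtain ⟨n, hn, hf⟩ := exists_fix_gt w (i + 1)
  rw [doubleSchubert_eq hf, dividedDifference_doubleSchubertAux_of_ascent hn h]

theorem dividedDifference_doubleSchubert_of_descent {w : SInf} {i : ℕ}
    (h : w.1 (i + 1) < w.1 i) :
    dividedDifference i (doubleSchubert w) = doubleSchubert (w * swapInf i (i + 1)) := by
  obtain ⟨n, hn, hf⟩ := exists_fix_gt w (i + 1)
  have hf' : ∀ j, n ≤ j → (w * swapInf i (i + 1)).1 j = j := fix_mul_swap hf (by omega) hn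
  rw [doubleSchubert_eq hf, doubleSchubert_eq hf',
    dividedDifference_doubleSchubertAux_of_descent hn h, coe_mul_swapInf]

theorem dividedDifference_doubleSchubert_mul_swapInf {w : SInf} {i : ℕ}
    (h : w.1 i < w.1 (i + 1)) :
    dividedDifference i (doubleSchubert (w * swapInf i (i + 1))) = doubleSchubert w := by
  rw [dividedDifference_doubleSchubert_of_descent
    (by rw [coe_mul_swapInf]; simpa using h), mul_assoc]
  congr 2
  exact mul_eq_left.2 (Subtype.ext (swap_mul_self i (i + 1)))

/-- The linear combination of double Schubert polynomials with given coefficients in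
`ℤ_{≥ 0}[t]`. -/
noncomputable def nonnegCombination :
    (SInf →₀ MvPolynomial ℕ ℕ) →+ MvPolynomial ℕ (MvPolynomial ℕ ℤ) :=
  Finsupp.liftAddHom fun w =>
    ((AddMonoidHom.mulRight (doubleSchubert w)).comp
      (C : MvPolynomial ℕ ℤ →+* MvPolynomial ℕ (MvPolynomial ℕ ℤ)).toAddMonoidHom).comp
      (map (Nat.castRingHom ℤ) : MvPolynomial ℕ ℕ →+* MvPolynomial ℕ ℤ).toAddMonoidHom

theorem nonnegCombination_apply (c : SInf →₀ MvPolynomial ℕ ℕ) :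
    nonnegCombination c =
      c.sum fun w a => C (map (Nat.castRingHom ℤ) a) * doubleSchubert w := rfl

theorem nonnegCombination_single (w : SInf) (a : MvPolynomial ℕ ℕ) :
    nonnegCombination (Finsupp.single w a) =
      C (map (Nat.castRingHom ℤ) a) * doubleSchubert w := by
  rw [nonnegCombination_apply, Finsupp.sum_single_index (by simp)]

/-- The cone `∑_w ℤ_{≥ 0}[t] 𝔖_w(x, t)`. -/
noncomputable def schubertCone : AddSubmonoid (MvPolynomial ℕ (MvPolynomial ℕ ℤ)) :=
  AddMonoidHom.mrange nonnegCombination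

theorem C_mul_doubleSchubert_mem (a : MvPolynomial ℕ ℕ) (w : SInf) :
    C (map (Nat.castRingHom ℤ) a) * doubleSchubert w ∈ schubertCone :=
  ⟨Finsupp.single w a, nonnegCombination_single w a⟩

theorem doubleSchubert_mem (w : SInf) : doubleSchubert w ∈ schubertCone := by
  simpa using C_mul_doubleSchubert_mem 1 w

theorem map_mem_schubertCone
    (F : MvPolynomial ℕ (MvPolynomial ℕ ℤ) →+ MvPolynomial ℕ (MvPolynomial ℕ ℤ))
    (hF : ∀ a w, F (C (map (Nat.castRingHom ℤ) a) * doubleSchubert w) ∈ schubertCone)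
    {f : MvPolynomial ℕ (MvPolynomial ℕ ℤ)} (hf : f ∈ schubertCone) : F f ∈ schubertCone := by
  obtain ⟨c, rfl⟩ := hf
  rw [nonnegCombination_apply, Finsupp.sum, map_sum]
  exact sum_mem fun w _ => hF _ w

theorem C_mul_mem (a : MvPolynomial ℕ ℕ) {f : MvPolynomial ℕ (MvPolynomial ℕ ℤ)}
    (hf : f ∈ schubertCone) : C (map (Nat.castRingHom ℤ) a) * f ∈ schubertCone := by
  refine map_mem_schubertCone (AddMonoidHom.mulLeft (C (map (Nat.castRingHom ℤ) a)))
    (fun b w => ?_) hf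
  rw [AddMonoidHom.coe_mulLeft, ← mul_assoc, ← C_mul, ← map_mul]
  exact C_mul_doubleSchubert_mem _ w

theorem apply_ne_apply_succ (w : Perm ℕ) (i : ℕ) : w i ≠ w (i + 1) := fun e => by
  simpa using w.injective e

theorem dividedDifference_mem (i : ℕ) {f : MvPolynomial ℕ (MvPolynomial ℕ ℤ)}
    (hf : f ∈ schubertCone) : dividedDifference i f ∈ schubertCone := by
  refine map_mem_schubertCone (dividedDifferenceHom i) (fun a w => ?_) hf
  rw [dividedDifferenceHom_apply, dividedDifference_C_mul]
  refine C_mul_mem a ?_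
  rcases (apply_ne_apply_succ w.1 i).lt_or_gt with h | h
  · rw [dividedDifference_doubleSchubert_of_ascent h]
    exact zero_mem _
  · rw [dividedDifference_doubleSchubert_of_descent h]
    exact doubleSchubert_mem _

/-! ### Multiplication by `x_1 ⋯ x_m` -/

theorem X_mul_doubleSchubert {w : SInf} {m : ℕ}
    (h : ∀ a b, a < b → b < m + 1 → w.1 b < w.1 a) :
    ∃ s : Finset ℕ, (∀ j ∈ s, m < j) ∧
      X m * doubleSchubert w = C (X (w.1 m)) * doubleSchubert w +
        ∑ j ∈ s, doubleSchubert (w * swapInf m j) := by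
  classical
  obtain ⟨N, hN, hf⟩ := exists_fix_gt w m
  have hf' : ∀ i, N + 1 ≤ i → w.1 i = i := fun i hi => hf i (by omega)
  refine ⟨(Finset.range (N + 1)).filter fun j => IsCover w.1 m j,
    fun j hj => (Finset.mem_filter.1 hj).2.1, ?_⟩
  -- A negative Monk term needs a smaller letter before position `m`, which the decreasing prefix
  -- excludes.
  have h0 : ∑ j ∈ Finset.range (N + 1), monkTerm (N + 1) w.1 j m = 0 :=
    Finset.sum_eq_zero fun j _ => if_neg fun e => by
      have := h j m e.1 m.lt_succ_self
      have := e.2.1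
      omega
  have := monkFormula hf hN
  rw [MonkFormula, h0, sub_zero] at this
  rw [doubleSchubert_eq hf', this, Finset.sum_filter]
  congr 1
  refine Finset.sum_congr rfl fun j hj => ?_
  rw [monkTerm]
  split_ifs
  · have hfs : ∀ i, N + 1 ≤ i → (w * swapInf m j).1 i = i :=
      fix_mul_swap hf' (by omega) (Finset.mem_range.1 hj)
    rw [doubleSchubert_eq hfs, coe_mul_swapInf]
  · rfl

theorem prod_X_mul_doubleSchubert_mem_of_anti {m : ℕ} {w : SInf}
    (h : ∀ a b, a < b → b < m → w.1 b < w.1 a) :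
    (∏ i ∈ Finset.range m, X i) * doubleSchubert w ∈ schubertCone := by
  induction m generalizing w with
  | zero => simpa using doubleSchubert_mem w
  | succ m ih =>
    obtain ⟨s, hs, e⟩ := X_mul_doubleSchubert h
    rw [Finset.prod_range_succ, mul_assoc, e, mul_add, Finset.mul_sum]
    -- The transpositions involve only position `m` and later ones, so the first `m` letters stay
    -- decreasing.
    refine add_mem ?_ (sum_mem fun j hj => ih fun a b hab hb => ?_)
    · have := C_mul_mem (X (w.1 m)) (ih fun a b hab hb => h a b hab (by omega))
      rwa [map_X, mul_left_comm] at this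
    · have := hs j hj
      rw [coe_mul_swapInf, Perm.mul_apply, Perm.mul_apply,
        swap_apply_of_ne_of_ne (by omega) (by omega), swap_apply_of_ne_of_ne (by omega) (by omega)]
      exact h a b hab (by omega)

theorem rename_swap_prod_X {m i : ℕ} (hi : i + 1 < m) {R : Type*} [CommRing R] :
    rename (swap i (i + 1)) (∏ j ∈ Finset.range m, X j : MvPolynomial ℕ R) =
      ∏ j ∈ Finset.range m, X j := by
  rw [map_prod]
  simp only [rename_X]
  refine Finset.prod_bij' (fun a _ => swap i (i + 1) a) (fun a _ => swap i (i + 1) a)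
    ?_ ?_ (by simp) (by simp) (by simp) <;>
  · intro a ha
    simp only [Finset.mem_range, swap_apply_def] at ha ⊢
    grind

/-- The product is symmetric in its variables, so it commutes with the `∂_i` that lower a
permutation with decreasing prefix to `w`. -/
theorem prod_X_mul_doubleSchubert_mem (m : ℕ) (w : SInf) :
    (∏ i ∈ Finset.range m, X i) * doubleSchubert w ∈ schubertCone := by
  induction hs : ∑ j ∈ Finset.range m, j * w.1 j using Nat.strong_induction_on generalizing w with
  | _ s ih =>
  by_cases h : (ascents m w.1).Nonempty
  · obtain ⟨i, hi⟩ := h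
    rw [← dividedDifference_doubleSchubert_mul_swapInf hi.2,
      ← dividedDifference_symm_mul (rename_swap_prod_X hi.1)]
    exact dividedDifference_mem i (ih _ (hs ▸ sum_mul_swap_lt w.1 hi.1 hi.2) _ rfl)
  · exact prod_X_mul_doubleSchubert_mem_of_anti (anti_of_ascents_eq_empty h)

/-- The polynomials multiplication by which preserves the cone. -/
noncomputable def coneMultipliers : Submonoid (MvPolynomial ℕ (MvPolynomial ℕ ℤ)) where
  carrier := {g | ∀ f ∈ schubertCone, g * f ∈ schubertCone}
  mul_mem' := fun {a b} ha hb f hf => by rw [mul_assoc]; exact ha _ (hb f hf)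
  one_mem' := fun f hf => by rwa [one_mul]

theorem prod_X_mem_coneMultipliers (m : ℕ) :
    ∏ i ∈ Finset.range m, X i ∈ coneMultipliers := by
  intro f hf
  refine map_mem_schubertCone (AddMonoidHom.mulLeft (∏ i ∈ Finset.range m, X i))
    (fun a w => ?_) hf
  rw [AddMonoidHom.coe_mulLeft, mul_left_comm]
  exact C_mul_mem a (prod_X_mul_doubleSchubert_mem m w)

theorem prod_X_pow_mem_coneMultipliers (n : ℕ) {c : ℕ → ℕ} (hc : Antitone c) :
    ∏ i ∈ Finset.range n, X i ^ c i ∈ coneMultipliers := by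
  induction n generalizing c with
  | zero => simp
  | succ n ih =>
    -- Split off the `c n` columns of full height `n + 1` from the partition.
    have e : ∏ i ∈ Finset.range (n + 1), (X i : MvPolynomial ℕ (MvPolynomial ℕ ℤ)) ^ c i =
        (∏ i ∈ Finset.range (n + 1), X i) ^ c n *
          ∏ i ∈ Finset.range n, X i ^ (c i - c n) := by
      rw [← Finset.prod_pow, Finset.prod_range_succ, Finset.prod_range_succ, mul_right_comm,
        ← Finset.prod_mul_distrib]
      congr 1
      refine Finset.prod_congr rfl fun i hi => ?_
      have := hc (Finset.mem_range.1 hi).le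
      rw [← pow_add]
      congr 1
      omega
    rw [e]
    exact mul_mem (pow_mem (prod_X_mem_coneMultipliers _) _)
      (ih fun a b hab => Nat.sub_le_sub_right (hc hab) _)

/-! ### Reduction of separated descents to dominant `u` -/

theorem IsDominant.antitone_code {w : Perm ℕ} (hw : IsDominant w) (n : ℕ) :
    Antitone (code n w) := by
  refine antitone_nat_of_succ_le fun i => ?_
  rcases (apply_ne_apply_succ w i).lt_or_gt with h | h
  · exact (hw.code_succ h n).le
  · refine Finset.card_le_card fun j hj => ?_
    simp only [Finset.mem_filter] at hj ⊢
    exact ⟨hj.1, by omega, by omega⟩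

theorem isDominant_of_anti_of_mono {k : ℕ} {w : Perm ℕ}
    (ha : ∀ a b, a < b → b < k → w b < w a) (hm : ∀ i, k ≤ i → w i < w (i + 1)) :
    IsDominant w := by
  intro a b c hab hbc hac
  by_cases hb : b < k
  · exact (ha a b hab hb).trans hac
  · have : ∀ c, b + 1 ≤ c → w b < w c := fun c hc => by
      induction c, hc using Nat.le_induction with
      | base => exact hm b (by omega)
      | succ c hc ih => exact ih.trans (hm c (by omega))
    exact this c hbc

/-- The single Schubert polynomial as a polynomial with coefficients in `ℤ[t]`. -/
theorem map_C_schubert (u : SInf) :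
    map C (schubert u) =
      map ((C : ℤ →+* MvPolynomial ℕ ℤ).comp constantCoeff) (doubleSchubert u) :=
  map_map _ _ _

theorem map_C_schubert_mem_coneMultipliers {u : SInf} (hu : IsDominant u.1) :
    map C (schubert u) ∈ coneMultipliers := by
  obtain ⟨n, hn⟩ := exists_fix u
  have : map C (schubert u) = ∏ i ∈ Finset.range n,
      (X i : MvPolynomial ℕ (MvPolynomial ℕ ℤ)) ^ code n u.1 i := by
    rw [map_C_schubert, doubleSchubert_eq hn, doubleSchubertAux_of_isDominant hu, diagramProd]
    simp [map_prod]
  rw [this]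
  exact prod_X_pow_mem_coneMultipliers n (hu.antitone_code n)

theorem map_C_schubert_mul_doubleSchubert_mem {k : ℕ} {u v : SInf}
    (hu : ∀ i, k ≤ i → u.1 i < u.1 (i + 1)) (hv : ∀ i, i + 1 < k → v.1 i < v.1 (i + 1)) :
    map C (schubert u) * doubleSchubert v ∈ schubertCone := by
  induction hs : ∑ j ∈ Finset.range k, j * u.1 j using Nat.strong_induction_on generalizing u with
  | _ s ih =>
  by_cases h : (ascents k u.1).Nonempty
  · obtain ⟨i, hik, hi⟩ := h
    have hsymm : rename (swap i (i + 1)) (doubleSchubert v) = doubleSchubert v :=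
      rename_swap_of_dividedDifference_eq_zero
        (dividedDifference_doubleSchubert_of_ascent (hv i hik))
    have e : map C (schubert u) * doubleSchubert v = dividedDifference i
        (map C (schubert (u * swapInf i (i + 1))) * doubleSchubert v) := by
      rw [mul_comm _ (doubleSchubert v), mul_comm _ (doubleSchubert v),
        dividedDifference_symm_mul hsymm, map_C_schubert, map_C_schubert, dividedDifference_map,
        dividedDifference_doubleSchubert_mul_swapInf hi]
    rw [e]
    -- Since `i + 1 < k`, the swap leaves the increasing tail of `u` untouched.
    refine dividedDifference_mem i (ih _ (hs ▸ sum_mul_swap_lt u.1 hik hi) (fun j hj => ?_) rfl)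
    rw [coe_mul_swapInf, Perm.mul_apply, Perm.mul_apply,
      swap_apply_of_ne_of_ne (by omega) (by omega), swap_apply_of_ne_of_ne (by omega) (by omega)]
    exact hu j hj
  · exact map_C_schubert_mem_coneMultipliers
      (isDominant_of_anti_of_mono (anti_of_ascents_eq_empty h) hu) _ (doubleSchubert_mem v)

/-- Without boundedness the supremum in `maxdes` would take its default value `0` and bound nothing.
-/
theorem bddAbove_descents (w : SInf) : BddAbove (descents w.1) := by
  obtain ⟨n, hn⟩ := exists_fix w
  refine ⟨n, ?_⟩
  rintro _ ⟨i, rfl, hi⟩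
  by_contra h
  rw [hn i (by omega), hn (i + 1) (by omega)] at hi
  omega

end SchubertCalc

theorem corollary6p2 (u v : SchubertCalc.SInf) (huv : SchubertCalc.SeparatedDescents u v) :
    ∃ c : SchubertCalc.SInf →₀ MvPolynomial ℕ ℕ,
      MvPolynomial.map MvPolynomial.C (SchubertCalc.schubert u) * SchubertCalc.doubleSchubert v =
        c.sum fun w a =>
          MvPolynomial.C (MvPolynomial.map (Nat.castRingHom ℤ) a) *
            SchubertCalc.doubleSchubert w := by
  obtain ⟨k, hu, hv⟩ := huv
  -- Descents are counted from `1`: a failure at index `i` is a descent `i + 1`, which exceeds `k`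
  -- here and lies below `k` in `hv'`.
  have hu' : ∀ i, k ≤ i → u.1 i < u.1 (i + 1) := fun i hi => by
    by_contra h
    have hne := SchubertCalc.apply_ne_apply_succ u.1 i
    have := (le_csSup (SchubertCalc.bddAbove_descents u) ⟨i, rfl, by omega⟩).trans hu
    omega
  have hv' : ∀ i, i + 1 < k → v.1 i < v.1 (i + 1) := fun i hi => by
    by_contra h
    have hne := SchubertCalc.apply_ne_apply_succ v.1 i
    have hmem : i + 1 ∈ SchubertCalc.descents v.1 := ⟨i, rfl, by omega⟩
    have : k ≤ i + 1 := ENat.natCast_le_natCast.1 (hv.trans (iInf₂_le (i + 1) hmem))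
    omega
  obtain ⟨c, hc⟩ := SchubertCalc.map_C_schubert_mul_doubleSchubert_mem hu' hv'
  exact ⟨c, hc.symm⟩
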